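/- Let $a,b,p,q,c,d,s,t\geq 2$ be integers, and for $n \ge 2$ let $F_n$ denote the free group of rank $n$. Let $G_1=(F_a\times F_b)*(F_p\times F_q)$ and $G_2=(F_c\times F_d)*(F_s\times F_t)$, where $*$ denotes the free product of groups. If $$(a-1)(b-1)+(p-1)(q-1)=(c-1)(d-1)+(s-1)(t-1),$$ then $G_1$ and $G_2$ are commensurable, that is, there are subgroups $H_1\le G_1$ and $H_2\le G_2$ of finite index such that $H_1$ and $H_2$ are isomorphic. -/

import Mathlib

/-- Two groups are (abstractly) commensurable if they have isomorphic subgroups of finite index. -/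
def AbstractlyCommensurable (G H : Type*) [Group G] [Group H] : Prop :=
  ∃ (K : Subgroup G) (L : Subgroup H), K.FiniteIndex ∧ L.FiniteIndex ∧ Nonempty (K ≃* L)

/-- The free group of rank `n`. -/
abbrev FreeGroupOfRank (n : ℕ) : Type := FreeGroup (Fin n)

/-- The free product `(F_a × F_b) ∗ (F_p × F_q)` of two direct products of free groups. -/
abbrev FreeProdOfProducts (a b p q : ℕ) : Type :=
  Monoid.Coprod (FreeGroupOfRank a × FreeGroupOfRank b) (FreeGroupOfRank p × FreeGroupOfRank q)

/-!
Let `A₀ ≤ A` and `B₀ ≤ B` have index `m` and `n`. The cover of `K(A, 1) ∨ K(B, 1)` with one sheet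
for each pair of cosets shows that `A ∗ B` has a subgroup of index `m * n` which is the free product
of `n` copies of `A₀`, `m` copies of `B₀` and a free group of rank `(m - 1) * (n - 1)`.
Algebraically, let `H` be this free product; then `A` acts on `(A ⧸ A₀ × B ⧸ B₀) × H` by induction
from `A₀`, and `B` by induction from `B₀`, and the resulting action of `A ∗ B` is its left
translation action in coordinates, so that `H` embeds in `A ∗ B` with the expected index.
Unwinding one free generator by a `g`-fold cyclic cover multiplies the numbers of factors by `g`.

Now let `A = F_{a+1} × F_{b+1}` and `B = F_{p+1} × F_{q+1}`, let `x` be a common multiple of `a` and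
`p`, and `y` one of `b` and `q`. Both `A` and `B` contain a copy of `M = F_{x+1} × F_{y+1}`, with
indices `m = (x / a) * (y / b)` and `n = (x / p) * (y / q)`. For `g = a * b * p * q` the result is a
subgroup of index `g * m * n = (x * y) ^ 2`, the free product of
`g * (m + n) = x * y * (a * b + p * q)` copies of `M` and a free group whose rank is one more than
the difference of these two numbers. It depends only on `x`, `y` and `a * b + p * q`, and `x` and
`y` can be chosen to serve both groups of the theorem.
-/

open Monoid Equiv

/-- `H` embeds in `G` as a subgroup of index `n`, where `n = 0` stands for infinite index. -/
def EmbedsWithIndex (H G : Type*) [Group H] [Group G] (n : ℕ) : Prop :=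
  ∃ f : H →* G, Function.Injective f ∧ f.range.index = n

namespace EmbedsWithIndex

variable {G H K G' H' : Type*} [Group G] [Group H] [Group K] [Group G'] [Group H'] {m n : ℕ}

theorem of_mulEquiv (e : H ≃* G) : EmbedsWithIndex H G 1 :=
  ⟨e.toMonoidHom, e.injective, by
    rw [MonoidHom.range_eq_top.2 e.surjective, Subgroup.index_top]⟩

theorem trans (h₁ : EmbedsWithIndex K H m) (h₂ : EmbedsWithIndex H G n) :
    EmbedsWithIndex K G (m * n) := by
  obtain ⟨f, hf, rfl⟩ := h₁
  obtain ⟨g, hg, rfl⟩ := h₂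
  exact ⟨g.comp f, hg.comp hf, by
    rw [MonoidHom.range_comp, Subgroup.index_map_of_injective _ hg]⟩

theorem congr_left (e : K ≃* H) (h : EmbedsWithIndex H G n) : EmbedsWithIndex K G n := by
  simpa only [one_mul] using (of_mulEquiv e).trans h

theorem congr_right (h : EmbedsWithIndex H G n) (e : G ≃* K) : EmbedsWithIndex H K n := by
  simpa only [mul_one] using h.trans (of_mulEquiv e)

theorem prod (h₁ : EmbedsWithIndex H G m) (h₂ : EmbedsWithIndex H' G' n) :
    EmbedsWithIndex (H × H') (G × G') (m * n) := by
  obtain ⟨f, hf, rfl⟩ := h₁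
  obtain ⟨g, hg, rfl⟩ := h₂
  refine ⟨f.prodMap g, hf.prodMap hg, ?_⟩
  rw [← Subgroup.index_prod, MonoidHom.range_prodMap]

theorem exists_subgroup (h : EmbedsWithIndex H G n) :
    ∃ A : Subgroup G, A.index = n ∧ Nonempty (H ≃* A) := by
  obtain ⟨f, hf, hn⟩ := h
  exact ⟨f.range, hn, ⟨MonoidHom.ofInjective hf⟩⟩

theorem abstractlyCommensurable (h₁ : EmbedsWithIndex K G m) (h₂ : EmbedsWithIndex K H n)
    (hm : m ≠ 0) (hn : n ≠ 0) : AbstractlyCommensurable G H := by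
  obtain ⟨A, rfl, ⟨e⟩⟩ := h₁.exists_subgroup
  obtain ⟨B, rfl, ⟨e'⟩⟩ := h₂.exists_subgroup
  exact ⟨A, B, ⟨hm⟩, ⟨hn⟩, ⟨e.symm.trans e'⟩⟩

theorem of_bijective {S : Type*} (f : H →* G) (t : S → G)
    (h : Function.Bijective fun p : S × H => t p.1 * f p.2) :
    EmbedsWithIndex H G (Nat.card S) := by
  obtain ⟨⟨s₀, _⟩, _⟩ := h.surjective 1
  refine ⟨f, fun k k' hk => ?_, (Nat.card_eq_of_bijective (fun s => (t s : G ⧸ f.range))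
    ⟨fun s s' hs => ?_, fun q => ?_⟩).symm⟩
  · have : (s₀, k) = (s₀, k') := h.injective (by simp only [hk])
    exact congrArg Prod.snd this
  · obtain ⟨k, hk⟩ := QuotientGroup.eq.1 hs
    have : (s, k) = (s', 1) := h.injective (by simp [hk])
    exact congrArg Prod.fst this
  · obtain ⟨g, rfl⟩ := QuotientGroup.mk_surjective q
    obtain ⟨⟨s, k⟩, rfl⟩ := h.surjective g
    exact ⟨s, QuotientGroup.eq.2 ⟨k, by simp⟩⟩

end EmbedsWithIndex

/-- A choice of representatives for the left cosets of `A₀` in which the trivial coset is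
represented by `1`. -/
structure CosetSection {A : Type*} [Group A] (A₀ : Subgroup A) where
  rep : A ⧸ A₀ → A
  mk_rep : ∀ x, (rep x : A ⧸ A₀) = x
  rep_one : rep (1 : A) = 1

namespace CosetSection

variable {A : Type*} [Group A] {A₀ : Subgroup A}

theorem nonempty (A₀ : Subgroup A) : Nonempty (CosetSection A₀) := by
  classical
  refine ⟨Function.update Quotient.out ((1 : A) : A ⧸ A₀) 1, fun x => ?_, by simp⟩
  obtain rfl | hx := eq_or_ne x (1 : A)
  · rw [Function.update_self]
  · rw [Function.update_of_ne hx, QuotientGroup.out_eq']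

variable (R : CosetSection A₀)

/-- The cocycle `A × A ⧸ A₀ → A₀` of the section `R`: it measures by how much `R.rep` fails to be
equivariant. -/
def cocycle (a : A) (x : A ⧸ A₀) : A₀ :=
  ⟨(R.rep (a • x))⁻¹ * (a * R.rep x), QuotientGroup.eq.1 <| by
    rw [R.mk_rep, ← smul_eq_mul, ← MulAction.Quotient.smul_coe, R.mk_rep]⟩

theorem coe_cocycle (a : A) (x : A ⧸ A₀) :
    (R.cocycle a x : A) = (R.rep (a • x))⁻¹ * (a * R.rep x) := rfl

theorem cocycle_one (x : A ⧸ A₀) : R.cocycle 1 x = 1 := by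
  ext; simp [coe_cocycle]

theorem cocycle_mul (a b : A) (x : A ⧸ A₀) :
    R.cocycle (a * b) x = R.cocycle a (b • x) * R.cocycle b x := by
  ext
  simp only [coe_cocycle, Subgroup.coe_mul, mul_smul]
  group

theorem rep_smul_one (x : A ⧸ A₀) : R.rep x • ((1 : A) : A ⧸ A₀) = x := by
  rw [MulAction.Quotient.smul_coe, smul_eq_mul, mul_one, R.mk_rep]

theorem cocycle_rep (x : A ⧸ A₀) : R.cocycle (R.rep x) (1 : A) = 1 := by
  ext; simp only [coe_cocycle, rep_smul_one, rep_one, mul_one, inv_mul_cancel, Subgroup.coe_one]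

theorem coe_smul_one (a : A₀) : (a : A) • ((1 : A) : A ⧸ A₀) = (1 : A) := by
  rw [MulAction.Quotient.smul_coe, smul_eq_mul, mul_one]
  exact (QuotientGroup.eq.2 (by simp)).symm

theorem cocycle_coe (a : A₀) : R.cocycle a (1 : A) = a := by
  ext; simp only [coe_cocycle, coe_smul_one, rep_one, mul_one, inv_one, one_mul]

section InducedAction

variable {ι H G : Type*} [Group H] [Group G] (φ : ι → A₀ →* H)

/-- The action of `A` on `(A ⧸ A₀ × {i}) × H` induced from the left translation action of `A₀` on
`H` through `φ i`, simultaneously for all `i`. -/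
def inducedAction : A →* Perm (((A ⧸ A₀) × ι) × H) :=
  MonoidHom.toHomPerm
    { toFun a p := ((a • p.1.1, p.1.2), φ p.1.2 (R.cocycle a p.1.1) * p.2)
      map_one' := by
        funext p
        simp only [one_smul, cocycle_one, map_one, one_mul]
        rfl
      map_mul' a b := by
        funext p
        simp only [cocycle_mul, mul_smul, map_mul, mul_assoc]
        rfl }

theorem inducedAction_apply (a : A) (x : A ⧸ A₀) (i : ι) (h : H) :
    R.inducedAction φ a ((x, i), h) = ((a • x, i), φ i (R.cocycle a x) * h) := rfl

theorem inducedAction_rep (x : A ⧸ A₀) (i : ι) (h : H) :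
    R.inducedAction φ (R.rep x) (((1 : A), i), h) = ((x, i), h) := by
  rw [inducedAction_apply, rep_smul_one, cocycle_rep, map_one, one_mul]

theorem inducedAction_coe (a : A₀) (i : ι) (h : H) :
    R.inducedAction φ a (((1 : A), i), h) = ((((1 : A) : A ⧸ A₀), i), φ i a * h) := by
  rw [inducedAction_apply, coe_smul_one, cocycle_coe]

theorem rep_mul_inducedAction (ψ : A →* G) (c : ι → G) (f : H →* G)
    (hf : ∀ i a, f (φ i a) = (c i)⁻¹ * ψ a * c i) (a : A) (p : ((A ⧸ A₀) × ι) × H) :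
    ψ (R.rep (R.inducedAction φ a p).1.1) * c (R.inducedAction φ a p).1.2 *
        f (R.inducedAction φ a p).2 =
      ψ a * (ψ (R.rep p.1.1) * c p.1.2 * f p.2) := by
  obtain ⟨⟨x, i⟩, h⟩ := p
  simp only [inducedAction_apply, map_mul, hf, coe_cocycle, map_inv]
  group

end InducedAction

end CosetSection

/-- The fundamental group of the cover of `K(A, 1) ∨ K(B, 1)` with one sheet for each pair of cosets
in `A ⧸ A₀ × B ⧸ B₀`: a free product of copies of `A₀` indexed by the cosets of `B₀`, copies of
`B₀` indexed by the cosets of `A₀`, and a free group on the pairs of nontrivial cosets. -/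
def CosetCoprod {A B : Type*} [Group A] [Group B] (A₀ : Subgroup A) (B₀ : Subgroup B) : Type _ :=
  Coprod (Coprod (CoprodI fun _ : B ⧸ B₀ => A₀) (CoprodI fun _ : A ⧸ A₀ => B₀))
    (FreeGroup ({x : A ⧸ A₀ // x ≠ (1 : A)} × {y : B ⧸ B₀ // y ≠ (1 : B)}))

namespace CosetCoprod

variable {A B : Type*} [Group A] [Group B] {A₀ : Subgroup A} {B₀ : Subgroup B}

instance : Group (CosetCoprod A₀ B₀) := inferInstanceAs (Group (Coprod _ (FreeGroup _)))

/-- The identity map, as an isomorphism onto the defining free product. -/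
def mulEquivCoprod (A₀ : Subgroup A) (B₀ : Subgroup B) : CosetCoprod A₀ B₀ ≃*
    Coprod (Coprod (CoprodI fun _ : B ⧸ B₀ => A₀) (CoprodI fun _ : A ⧸ A₀ => B₀))
      (FreeGroup ({x : A ⧸ A₀ // x ≠ (1 : A)} × {y : B ⧸ B₀ // y ≠ (1 : B)})) :=
  MulEquiv.refl _

/-- The free factor `A₀` of `CosetCoprod A₀ B₀` with index `y`. -/
def left (y : B ⧸ B₀) : A₀ →* CosetCoprod A₀ B₀ :=
  (mulEquivCoprod A₀ B₀).symm.toMonoidHom.comp <| Coprod.inl.comp <| Coprod.inl.comp <|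
    CoprodI.of (M := fun _ : B ⧸ B₀ => A₀) (i := y)

/-- The free factor `B₀` of `CosetCoprod A₀ B₀` with index `x`. -/
def right (x : A ⧸ A₀) : B₀ →* CosetCoprod A₀ B₀ :=
  (mulEquivCoprod A₀ B₀).symm.toMonoidHom.comp <| Coprod.inl.comp <| Coprod.inr.comp <|
    CoprodI.of (M := fun _ : A ⧸ A₀ => B₀) (i := x)

open Classical in
/-- The free generator of `CosetCoprod A₀ B₀` with index `(x, y)`, extended by `1` to the pairs in
which one coset is trivial. -/
noncomputable def loop (x : A ⧸ A₀) (y : B ⧸ B₀) : CosetCoprod A₀ B₀ :=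
  if h : x ≠ (1 : A) ∧ y ≠ (1 : B) then
    (mulEquivCoprod A₀ B₀).symm (Coprod.inr (FreeGroup.of (⟨x, h.1⟩, ⟨y, h.2⟩)))
  else 1

theorem loop_one_left (y : B ⧸ B₀) : loop ((1 : A) : A ⧸ A₀) y = 1 := dif_neg (by simp)

theorem loop_one_right (x : A ⧸ A₀) : loop x ((1 : B) : B ⧸ B₀) = 1 := dif_neg (by simp)

theorem loop_coe (x : {x : A ⧸ A₀ // x ≠ (1 : A)}) (y : {y : B ⧸ B₀ // y ≠ (1 : B)}) :
    loop x.1 y.1 = (mulEquivCoprod A₀ B₀).symm (Coprod.inr (FreeGroup.of (x, y))) :=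
  dif_pos ⟨x.2, y.2⟩

theorem hom_ext {G : Type*} [Monoid G] {f g : CosetCoprod A₀ B₀ →* G}
    (hleft : ∀ y a, f (left y a) = g (left y a)) (hright : ∀ x b, f (right x b) = g (right x b))
    (hloop : ∀ x y, f (loop x y) = g (loop x y)) : f = g := by
  have h : f.comp (mulEquivCoprod A₀ B₀).symm.toMonoidHom =
      g.comp (mulEquivCoprod A₀ B₀).symm.toMonoidHom := by
    ext i x
    · exact hleft i x
    · exact hright i x
    · have hi := hloop i.1 i.2
      rwa [loop_coe] at hi
  ext k
  obtain ⟨k, rfl⟩ := (mulEquivCoprod A₀ B₀).symm.surjective k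
  exact DFunLike.congr_fun h k

section Lift

variable {G : Type*} [Group G] (f : B ⧸ B₀ → A₀ →* G) (g : A ⧸ A₀ → B₀ →* G)
  (c : A ⧸ A₀ → B ⧸ B₀ → G)

/-- The homomorphism from `CosetCoprod A₀ B₀` with prescribed values on the free factors and on the
free generators. -/
def lift : CosetCoprod A₀ B₀ →* G :=
  (Coprod.lift (Coprod.lift (CoprodI.lift f) (CoprodI.lift g))
    (FreeGroup.lift fun p => c p.1 p.2)).comp (mulEquivCoprod A₀ B₀).toMonoidHom

theorem lift_left (y : B ⧸ B₀) (a : A₀) : lift f g c (left y a) = f y a := by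
  simp [lift, left]

theorem lift_right (x : A ⧸ A₀) (b : B₀) : lift f g c (right x b) = g x b := by
  simp [lift, right]

variable {c} in
theorem lift_loop (hx : ∀ y, c (1 : A) y = 1) (hy : ∀ x, c x (1 : B) = 1) (x : A ⧸ A₀)
    (y : B ⧸ B₀) : lift f g c (loop x y) = c x y := by
  obtain rfl | hx' := eq_or_ne x (1 : A)
  · rw [loop_one_left, map_one, hx]
  obtain rfl | hy' := eq_or_ne y (1 : B)
  · rw [loop_one_right, map_one, hy]
  · simp [lift, loop_coe ⟨x, hx'⟩ ⟨y, hy'⟩]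

end Lift

theorem subgroup_eq_top {L : Subgroup (CosetCoprod A₀ B₀)} (hleft : ∀ y a, left y a ∈ L)
    (hright : ∀ x b, right x b ∈ L) (hloop : ∀ x y, loop x y ∈ L) : L = ⊤ := by
  let f : CosetCoprod A₀ B₀ →* L := lift (fun y => (left y).codRestrict L (hleft y))
    (fun x => (right x).codRestrict L (hright x)) fun x y => ⟨loop x y, hloop x y⟩
  have hf : L.subtype.comp f = MonoidHom.id _ := by
    refine hom_ext (fun y a => ?_) (fun x b => ?_) fun x y => ?_
    · exact congrArg Subtype.val (lift_left _ _ _ y a)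
    · exact congrArg Subtype.val (lift_right _ _ _ x b)
    · exact congrArg Subtype.val (lift_loop _ _ (fun y => Subtype.ext (loop_one_left y))
        (fun x => Subtype.ext (loop_one_right x)) x y)
  refine eq_top_iff.2 fun k _ => ?_
  have hk : (f k : CosetCoprod A₀ B₀) = k := DFunLike.congr_fun hf k
  exact hk ▸ (f k).2

variable (R : CosetSection A₀) (S : CosetSection B₀)

/-- The inclusion of `CosetCoprod A₀ B₀` into `A ∗ B` determined by choices of coset
representatives: the free factors go to conjugates of `A₀` and `B₀`, and the free generators to
commutators of representatives. -/
def toCoprod : CosetCoprod A₀ B₀ →* Coprod A B :=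
  lift
    (fun y => ((MulAut.conj (Coprod.inr (S.rep y))⁻¹).toMonoidHom.comp Coprod.inl).comp A₀.subtype)
    (fun x => ((MulAut.conj (Coprod.inl (R.rep x))⁻¹).toMonoidHom.comp Coprod.inr).comp B₀.subtype)
    (fun x y => (Coprod.inr (S.rep y) * Coprod.inl (R.rep x))⁻¹ *
      (Coprod.inl (R.rep x) * Coprod.inr (S.rep y)))

theorem toCoprod_left (y : B ⧸ B₀) (a : A₀) : toCoprod R S (left y a) =
    (Coprod.inr (S.rep y))⁻¹ * Coprod.inl (a : A) * Coprod.inr (S.rep y) := by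
  simp [toCoprod, lift_left]

theorem toCoprod_right (x : A ⧸ A₀) (b : B₀) : toCoprod R S (right x b) =
    (Coprod.inl (R.rep x))⁻¹ * Coprod.inr (b : B) * Coprod.inl (R.rep x) := by
  simp [toCoprod, lift_right]

theorem toCoprod_loop (x : A ⧸ A₀) (y : B ⧸ B₀) : toCoprod R S (loop x y) =
    (Coprod.inr (S.rep y) * Coprod.inl (R.rep x))⁻¹ *
      (Coprod.inl (R.rep x) * Coprod.inr (S.rep y)) :=
  lift_loop _ _ (fun y => by simp [R.rep_one]) (fun x => by simp [S.rep_one]) x y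

/-- The change of coordinates relating `A ⧸ A₀ × B ⧸ B₀ × CosetCoprod A₀ B₀` for `A` and for `B`. It
corrects for `A ∗ B` not being commutative: `loop x y` is mapped to the commutator by which
`inl (R.rep x) * inr (S.rep y)` and `inr (S.rep y) * inl (R.rep x)` differ. -/
noncomputable def shear :
    ((B ⧸ B₀) × (A ⧸ A₀)) × CosetCoprod A₀ B₀ ≃ ((A ⧸ A₀) × (B ⧸ B₀)) × CosetCoprod A₀ B₀ where
  toFun p := ((p.1.2, p.1.1), (loop p.1.2 p.1.1)⁻¹ * p.2)
  invFun p := ((p.1.2, p.1.1), loop p.1.1 p.1.2 * p.2)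
  left_inv _ := Prod.ext rfl (mul_inv_cancel_left _ _)
  right_inv _ := Prod.ext rfl (inv_mul_cancel_left _ _)

/-- The left translation action of `A ∗ B` on itself, in the coordinates given by the translates
`inl (R.rep x) * inr (S.rep y)` of the image of `toCoprod R S`. -/
noncomputable def action : Coprod A B →* Perm (((A ⧸ A₀) × (B ⧸ B₀)) × CosetCoprod A₀ B₀) :=
  Coprod.lift (R.inducedAction left) (shear.permCongrHom.toMonoidHom.comp (S.inducedAction right))

theorem action_inl (a : A) : action R S (Coprod.inl a) = R.inducedAction left a := by
  rw [action, Coprod.lift_apply_inl]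

theorem action_inr_shear (b : B) (p : ((B ⧸ B₀) × (A ⧸ A₀)) × CosetCoprod A₀ B₀) :
    action R S (Coprod.inr b) (shear p) = shear (S.inducedAction right b p) := by
  simp [action, Equiv.permCongr_apply]

/-- The element of `A ∗ B` with given coordinates. -/
def ofCoords (p : ((A ⧸ A₀) × (B ⧸ B₀)) × CosetCoprod A₀ B₀) : Coprod A B :=
  Coprod.inl (R.rep p.1.1) * Coprod.inr (S.rep p.1.2) * toCoprod R S p.2

theorem ofCoords_shear (p : ((B ⧸ B₀) × (A ⧸ A₀)) × CosetCoprod A₀ B₀) : ofCoords R S (shear p) =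
    Coprod.inr (S.rep p.1.1) * Coprod.inl (R.rep p.1.2) * toCoprod R S p.2 := by
  simp only [ofCoords, shear, Equiv.coe_fn_mk, map_mul, map_inv, toCoprod_loop]
  group

theorem ofCoords_action (g : Coprod A B) (p : ((A ⧸ A₀) × (B ⧸ B₀)) × CosetCoprod A₀ B₀) :
    ofCoords R S (action R S g p) = g * ofCoords R S p := by
  induction g using Coprod.induction_on generalizing p with
  | inl a =>
    rw [action_inl]
    exact R.rep_mul_inducedAction _ _ (fun y => Coprod.inr (S.rep y)) _ (toCoprod_left R S) a p
  | inr b =>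
    obtain ⟨p, rfl⟩ := shear.surjective p
    rw [action_inr_shear, ofCoords_shear, ofCoords_shear]
    exact S.rep_mul_inducedAction _ _ (fun x => Coprod.inl (R.rep x)) _ (toCoprod_right R S) b p
  | mul g k hg hk => rw [map_mul, Perm.mul_apply, hg, hk, mul_assoc]

theorem action_inl_rep (x : A ⧸ A₀) (y : B ⧸ B₀) (h : CosetCoprod A₀ B₀) :
    action R S (Coprod.inl (R.rep x)) (((1 : A), y), h) = ((x, y), h) := by
  rw [action_inl, R.inducedAction_rep]

theorem shear_apply (x : A ⧸ A₀) (y : B ⧸ B₀) (h : CosetCoprod A₀ B₀) :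
    shear ((y, x), h) = ((x, y), (loop x y)⁻¹ * h) := rfl

theorem action_inr_rep (x : A ⧸ A₀) (y : B ⧸ B₀) (h : CosetCoprod A₀ B₀) :
    action R S (Coprod.inr (S.rep y)) ((x, (1 : B)), h) = ((x, y), (loop x y)⁻¹ * h) := by
  have := action_inr_shear R S (S.rep y) (((1 : B), x), h)
  rwa [S.inducedAction_rep, shear_apply, shear_apply, loop_one_right, inv_one, one_mul] at this

theorem action_inr_coe (x : A ⧸ A₀) (b : B₀) (h : CosetCoprod A₀ B₀) :
    action R S (Coprod.inr (b : B)) ((x, (1 : B)), h) =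
      ((x, ((1 : B) : B ⧸ B₀)), right x b * h) := by
  have := action_inr_shear R S b (((1 : B), x), h)
  rwa [S.inducedAction_coe, shear_apply, shear_apply, loop_one_right, inv_one, one_mul,
    one_mul] at this

theorem action_toCoprod_left (y : B ⧸ B₀) (a : A₀) (h : CosetCoprod A₀ B₀) :
    action R S (toCoprod R S (left y a)) (((1 : A), (1 : B)), h) =
      ((((1 : A) : A ⧸ A₀), ((1 : B) : B ⧸ B₀)), left y a * h) := by
  simp only [toCoprod_left, map_mul, map_inv, Perm.mul_apply, Perm.inv_eq_iff_eq, action_inr_rep,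
    loop_one_left, action_inl, R.inducedAction_coe, inv_one, one_mul]

theorem action_toCoprod_right (x : A ⧸ A₀) (b : B₀) (h : CosetCoprod A₀ B₀) :
    action R S (toCoprod R S (right x b)) (((1 : A), (1 : B)), h) =
      ((((1 : A) : A ⧸ A₀), ((1 : B) : B ⧸ B₀)), right x b * h) := by
  simp only [toCoprod_right, map_mul, map_inv, Perm.mul_apply, Perm.inv_eq_iff_eq, action_inl_rep,
    action_inr_coe]

theorem action_toCoprod_loop (x : A ⧸ A₀) (y : B ⧸ B₀) (h : CosetCoprod A₀ B₀) :
    action R S (toCoprod R S (loop x y)) (((1 : A), (1 : B)), h) =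
      ((((1 : A) : A ⧸ A₀), ((1 : B) : B ⧸ B₀)), loop x y * h) := by
  rw [toCoprod_loop, map_mul, map_inv, Perm.mul_apply, Perm.inv_eq_iff_eq]
  simp only [map_mul, Perm.mul_apply, action_inr_rep, action_inl_rep, loop_one_left, inv_one,
    one_mul, inv_mul_cancel_left]

theorem action_toCoprod (k h : CosetCoprod A₀ B₀) :
    action R S (toCoprod R S k) (((1 : A), (1 : B)), h) =
      ((((1 : A) : A ⧸ A₀), ((1 : B) : B ⧸ B₀)), k * h) := by
  let L : Subgroup (CosetCoprod A₀ B₀) :=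
    { carrier := {k | ∀ h, action R S (toCoprod R S k) (((1 : A), (1 : B)), h) =
        ((((1 : A) : A ⧸ A₀), ((1 : B) : B ⧸ B₀)), k * h)}
      one_mem' h := by simp
      mul_mem' {k k'} hk hk' h := by rw [map_mul, map_mul, Perm.mul_apply, hk', hk, mul_assoc]
      inv_mem' {k} hk h := by
        rw [map_inv, map_inv, Perm.inv_eq_iff_eq, hk, mul_inv_cancel_left] }
  have hL : L = ⊤ := subgroup_eq_top (fun y a h => action_toCoprod_left R S y a h)
    (fun x b h => action_toCoprod_right R S x b h) (fun x y h => action_toCoprod_loop R S x y h)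
  exact (hL ▸ Subgroup.mem_top k : k ∈ L) h

theorem action_ofCoords (p : ((A ⧸ A₀) × (B ⧸ B₀)) × CosetCoprod A₀ B₀) :
    action R S (ofCoords R S p) (((1 : A), (1 : B)), 1) = p := by
  simp only [ofCoords, map_mul, Perm.mul_apply, action_toCoprod, action_inr_rep, action_inl_rep,
    loop_one_left, inv_one, one_mul, mul_one]

theorem bijective_ofCoords : Function.Bijective (ofCoords R S) := by
  refine Function.bijective_iff_has_inverse.2
    ⟨fun g => action R S g (((1 : A), (1 : B)), 1), action_ofCoords R S, fun g => ?_⟩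
  rw [ofCoords_action]
  simp only [ofCoords, R.rep_one, S.rep_one, map_one, mul_one]

theorem embedsWithIndex (A₀ : Subgroup A) (B₀ : Subgroup B) :
    EmbedsWithIndex (CosetCoprod A₀ B₀) (Coprod A B) (A₀.index * B₀.index) := by
  obtain ⟨R⟩ := CosetSection.nonempty A₀
  obtain ⟨S⟩ := CosetSection.nonempty B₀
  have h : EmbedsWithIndex (CosetCoprod A₀ B₀) (Coprod A B) (Nat.card ((A ⧸ A₀) × (B ⧸ B₀))) :=
    .of_bijective (toCoprod R S) (fun z => Coprod.inl (R.rep z.1) * Coprod.inr (S.rep z.2))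
      (bijective_ofCoords R S)
  rwa [Nat.card_prod] at h

theorem card_ne_eq_index_sub_one (A₀ : Subgroup A) [Finite (A ⧸ A₀)] :
    Nat.card {x : A ⧸ A₀ // x ≠ (1 : A)} = A₀.index - 1 := by
  rw [← Set.ncard_singleton ((1 : A) : A ⧸ A₀), Subgroup.index, ← Set.ncard_compl]
  rfl

end CosetCoprod

/-- Free products of copies of a group depend only on the group and the number of copies. -/
def coprodICongr {ι κ M N : Type*} [Monoid M] [Monoid N] (σ : ι ≃ κ) (e : M ≃* N) :
    (CoprodI fun _ : ι => M) ≃* (CoprodI fun _ : κ => N) :=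
  MonoidHom.toMulEquiv
    (CoprodI.lift fun i => (CoprodI.of (M := fun _ : κ => N) (i := σ i)).comp e.toMonoidHom)
    (CoprodI.lift fun k =>
      (CoprodI.of (M := fun _ : ι => M) (i := σ.symm k)).comp e.symm.toMonoidHom)
    (by
      ext i x
      simp only [MonoidHom.comp_apply, CoprodI.lift_of, MonoidHom.id_apply,
        MulEquiv.toMonoidHom_eq_coe, MonoidHom.coe_coe, MulEquiv.symm_apply_apply]
      rw [σ.symm_apply_apply])
    (by
      ext i x
      simp only [MonoidHom.comp_apply, CoprodI.lift_of, MonoidHom.id_apply,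
        MulEquiv.toMonoidHom_eq_coe, MonoidHom.coe_coe, MulEquiv.apply_symm_apply]
      rw [σ.apply_symm_apply])

/-- A free product over a disjoint union of index types is a binary free product. -/
def coprodISum {ι κ : Type*} (M : ι ⊕ κ → Type*) [∀ i, Monoid (M i)] :
    CoprodI M ≃* Coprod (CoprodI fun i => M (.inl i)) (CoprodI fun k => M (.inr k)) :=
  MonoidHom.toMulEquiv
    (CoprodI.lift (Sum.rec
      (fun i => Coprod.inl.comp (CoprodI.of (M := fun i => M (.inl i)) (i := i)))
      (fun k => Coprod.inr.comp (CoprodI.of (M := fun k => M (.inr k)) (i := k)))))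
    (Coprod.lift (CoprodI.lift fun i => CoprodI.of (M := M) (i := .inl i))
      (CoprodI.lift fun k => CoprodI.of (M := M) (i := .inr k)))
    (by ext (i | k) x <;> simp)
    (by ext <;> simp)

/-- Iterated free products of copies of a group are free products of copies of that group. -/
def coprodICoprodI (γ ι M : Type*) [Monoid M] :
    (CoprodI fun _ : γ => CoprodI fun _ : ι => M) ≃* CoprodI fun _ : γ × ι => M :=
  MonoidHom.toMulEquiv
    (CoprodI.lift fun c => CoprodI.lift fun i => CoprodI.of (M := fun _ : γ × ι => M) (i := (c, i)))
    (CoprodI.lift fun p => (CoprodI.of (M := fun _ : γ => CoprodI fun _ : ι => M) (i := p.1)).comp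
      (CoprodI.of (M := fun _ : ι => M) (i := p.2)))
    (by ext; simp)
    (by ext; simp)

/-- Indexed free products commute with binary free products. -/
def coprodICoprod {γ : Type*} (M N : γ → Type*) [∀ c, Monoid (M c)] [∀ c, Monoid (N c)] :
    (CoprodI fun c => Coprod (M c) (N c)) ≃* Coprod (CoprodI M) (CoprodI N) :=
  MonoidHom.toMulEquiv
    (CoprodI.lift fun _ => Coprod.map CoprodI.of CoprodI.of)
    (Coprod.lift
      (CoprodI.lift fun c =>
        (CoprodI.of (M := fun c => Coprod (M c) (N c)) (i := c)).comp Coprod.inl)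
      (CoprodI.lift fun c =>
        (CoprodI.of (M := fun c => Coprod (M c) (N c)) (i := c)).comp Coprod.inr))
    (by ext <;> simp)
    (by ext <;> simp)

/-- The free product over a one-element index type. -/
def coprodIUnique {ι : Type*} [Unique ι] (M : Type*) [Monoid M] : (CoprodI fun _ : ι => M) ≃* M :=
  MonoidHom.toMulEquiv (CoprodI.lift fun _ => MonoidHom.id M)
    (CoprodI.of (M := fun _ : ι => M) (i := default))
    (by
      ext i x
      obtain rfl := Unique.eq_default i
      simp)
    (by ext; simp)

/-- Free products of free groups are free: the binary case. -/
def coprodFreeGroup (ι κ : Type*) :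
    Coprod (FreeGroup ι) (FreeGroup κ) ≃* FreeGroup (ι ⊕ κ) :=
  MonoidHom.toMulEquiv
    (Coprod.lift (FreeGroup.map Sum.inl) (FreeGroup.map Sum.inr))
    (FreeGroup.lift (Sum.elim (fun i => Coprod.inl (FreeGroup.of i))
      (fun k => Coprod.inr (FreeGroup.of k))))
    (by ext <;> simp)
    (by ext (i | k) <;> simp)

/-- Free products of free groups are free: the case of copies of one group. -/
def coprodIFreeGroup (γ κ : Type*) :
    (CoprodI fun _ : γ => FreeGroup κ) ≃* FreeGroup (γ × κ) :=
  (coprodICongr (Equiv.refl γ) freeGroupEquivCoprodI).trans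
    ((coprodICoprodI _ _ _).trans freeGroupEquivCoprodI.symm)

/-- The free product of copies of `M` indexed by `ι` and of the free group on `κ`: the isomorphism
type of the finite-index subgroups to be compared. -/
abbrev CopiesCoprodFree (ι M κ : Type*) [Monoid M] : Type _ :=
  Coprod (CoprodI fun _ : ι => M) (FreeGroup κ)

namespace CopiesCoprodFree

variable {ι κ ι' κ' M : Type*} [Monoid M]

/-- Up to isomorphism, `CopiesCoprodFree ι M κ` depends on `ι` and `κ` only through their
cardinalities. -/
def reindex (σ : ι ≃ ι') (τ : κ ≃ κ') : CopiesCoprodFree ι M κ ≃* CopiesCoprodFree ι' M κ' :=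
  MulEquiv.coprodCongr (coprodICongr σ (MulEquiv.refl M)) (FreeGroup.freeGroupCongr τ)

variable (ι κ M)

/-- A free product of copies of `CopiesCoprodFree ι M κ` is again of this form. -/
def coprodIMulEquiv (γ : Type*) :
    (CoprodI fun _ : γ => CopiesCoprodFree ι M κ) ≃* CopiesCoprodFree (γ × ι) M (γ × κ) :=
  (coprodICoprod _ _).trans
    (MulEquiv.coprodCongr (coprodICoprodI γ ι M) (coprodIFreeGroup γ κ))

/-- `CopiesCoprodFree` absorbs free groups as free factors. -/
def freeGroupCoprodMulEquiv (κ' : Type*) :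
    Coprod (FreeGroup κ') (CopiesCoprodFree ι M κ) ≃* CopiesCoprodFree ι M (κ ⊕ κ') :=
  (MulEquiv.coprodComm _ _).trans ((MulEquiv.coprodAssoc _ _ _).trans
    (MulEquiv.coprodCongr (MulEquiv.refl _) (coprodFreeGroup _ _)))

end CopiesCoprodFree

namespace EmbedsWithIndex

variable {A B H K : Type*} [Group A] [Group B] [Group H] [Group K] {m n g : ℕ}

theorem coprod (h₁ : EmbedsWithIndex H A m) (h₂ : EmbedsWithIndex K B n) (hm : m ≠ 0)
    (hn : n ≠ 0) :
    EmbedsWithIndex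
      (Coprod (Coprod (CoprodI fun _ : Fin n => H) (CoprodI fun _ : Fin m => K))
        (FreeGroup (Fin ((m - 1) * (n - 1)))))
      (Coprod A B) (m * n) := by
  obtain ⟨A₀, rfl, ⟨e⟩⟩ := h₁.exists_subgroup
  obtain ⟨B₀, rfl, ⟨e'⟩⟩ := h₂.exists_subgroup
  have : Finite (A ⧸ A₀) := Nat.finite_of_card_ne_zero hm
  have : Finite (B ⧸ B₀) := Nat.finite_of_card_ne_zero hn
  have σ : {x : A ⧸ A₀ // x ≠ (1 : A)} × {y : B ⧸ B₀ // y ≠ (1 : B)} ≃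
      Fin ((A₀.index - 1) * (B₀.index - 1)) := by
    refine Finite.equivFinOfCardEq ?_
    rw [Nat.card_prod, CosetCoprod.card_ne_eq_index_sub_one,
      CosetCoprod.card_ne_eq_index_sub_one]
  refine (CosetCoprod.embedsWithIndex A₀ B₀).congr_left
    (.trans (.symm ?_) (CosetCoprod.mulEquivCoprod A₀ B₀).symm)
  exact MulEquiv.coprodCongr
    (MulEquiv.coprodCongr (coprodICongr (Finite.equivFin (B ⧸ B₀)) e.symm)
      (coprodICongr (Finite.equivFin (A ⧸ A₀)) e'.symm))
    (FreeGroup.freeGroupCongr σ)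

theorem coprod_left (h : EmbedsWithIndex H A m) (hm : m ≠ 0) :
    EmbedsWithIndex (Coprod H (CoprodI fun _ : Fin m => B)) (Coprod A B) m := by
  have h' := h.coprod (of_mulEquiv (MulEquiv.refl B)) hm one_ne_zero
  rw [Nat.sub_self, mul_zero, mul_one] at h'
  have e : FreeGroup (Fin 0) ≃* PUnit.{1} := MulEquiv.ofUnique
  have e' := MulEquiv.coprodCongr (coprodIUnique H (ι := Fin 1))
    (MulEquiv.refl (CoprodI fun _ : Fin m => B))
  exact h'.congr_left ((MulEquiv.coprodCongr e' e).trans (MulEquiv.coprodPUnit _)).symm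

theorem freeGroup_unit (hg : g ≠ 0) : EmbedsWithIndex (FreeGroup Unit) (FreeGroup Unit) g := by
  have e : FreeGroup Unit ≃* Multiplicative ℤ := FreeGroup.mulEquivIntOfUnique
  suffices h : EmbedsWithIndex (Multiplicative ℤ) (Multiplicative ℤ) g from
    (h.congr_left e).congr_right e.symm
  refine ⟨zpowersHom _ (Multiplicative.ofAdd (g : ℤ)), ?_, ?_⟩
  · intro a b hab
    have : a.toAdd * (g : ℤ) = b.toAdd * g := by
      simpa using congrArg Multiplicative.toAdd hab
    exact Multiplicative.toAdd.injective (mul_right_cancel₀ (by exact_mod_cast hg) this)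
  · have : (zpowersHom _ (Multiplicative.ofAdd (g : ℤ))).range =
        AddSubgroup.toSubgroup (AddSubgroup.zmultiples (g : ℤ)) := by
      ext x
      rfl
    rw [this, AddSubgroup.index_toSubgroup, Int.index_zmultiples, Int.natAbs_natCast]

theorem freeGroupOfRank (r : ℕ) (hg : g ≠ 0) :
    EmbedsWithIndex (FreeGroupOfRank (g * r + 1)) (FreeGroupOfRank (r + 1)) g := by
  have h := (freeGroup_unit hg).coprod_left (B := FreeGroup (Fin r)) hg
  have e := (MulEquiv.coprodCongr (MulEquiv.refl (FreeGroup Unit))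
    (coprodIFreeGroup (Fin g) (Fin r))).trans (coprodFreeGroup _ _)
  have σ : Unit ⊕ Fin g × Fin r ≃ Fin (g * r + 1) :=
    Fintype.equivOfCardEq (by simp [add_comm])
  have τ : Unit ⊕ Fin r ≃ Fin (r + 1) := Fintype.equivOfCardEq (by simp [add_comm])
  exact (h.congr_left (e.trans (FreeGroup.freeGroupCongr σ)).symm).congr_right
    ((coprodFreeGroup _ _).trans (FreeGroup.freeGroupCongr τ))

theorem copiesCoprodFree (M : Type*) [Group M] (n r : ℕ) (hg : g ≠ 0) :
    EmbedsWithIndex (CopiesCoprodFree (Fin (g * n)) M (Fin (g * r + 1)))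
      (CopiesCoprodFree (Fin n) M (Fin (r + 1))) g := by
  have h := (freeGroup_unit hg).coprod_left (B := CopiesCoprodFree (Fin n) M (Fin r)) hg
  have e := (MulEquiv.coprodCongr (MulEquiv.refl (FreeGroup Unit))
    (CopiesCoprodFree.coprodIMulEquiv (Fin n) (Fin r) M (Fin g))).trans
      (CopiesCoprodFree.freeGroupCoprodMulEquiv _ _ _ _)
  have σ : (Fin g × Fin r) ⊕ Unit ≃ Fin (g * r + 1) := Fintype.equivOfCardEq (by simp)
  have τ : Fin r ⊕ Unit ≃ Fin (r + 1) := Fintype.equivOfCardEq (by simp)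
  exact (h.congr_left (e.trans (CopiesCoprodFree.reindex finProdFinEquiv σ)).symm).congr_right
    ((CopiesCoprodFree.freeGroupCoprodMulEquiv _ _ _ _).trans
      (CopiesCoprodFree.reindex (Equiv.refl _) τ))

theorem coprod_self (h₁ : EmbedsWithIndex H A m) (h₂ : EmbedsWithIndex H B n) (hm : m ≠ 0)
    (hn : n ≠ 0) :
    EmbedsWithIndex (CopiesCoprodFree (Fin (n + m)) H (Fin ((m - 1) * (n - 1)))) (Coprod A B)
      (m * n) :=
  (h₁.coprod h₂ hm hn).congr_left <| MulEquiv.coprodCongr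
    ((coprodICongr finSumFinEquiv.symm (MulEquiv.refl H)).trans (coprodISum _)) (MulEquiv.refl _)

theorem coprod_self_cover {r : ℕ} (h₁ : EmbedsWithIndex H A m) (h₂ : EmbedsWithIndex H B n)
    (hm : m ≠ 0) (hn : n ≠ 0) (hg : g ≠ 0) (hr : r + (n + m) = m * n) :
    EmbedsWithIndex (CopiesCoprodFree (Fin (g * (n + m))) H (Fin (g * r + 1))) (Coprod A B)
      (g * (m * n)) := by
  have hrank : (m - 1) * (n - 1) = r + 1 := by
    obtain ⟨m, rfl⟩ := Nat.exists_eq_succ_of_ne_zero hm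
    obtain ⟨n, rfl⟩ := Nat.exists_eq_succ_of_ne_zero hn
    simp only [Nat.succ_eq_add_one, Nat.add_sub_cancel] at hr ⊢
    linarith
  have h := h₁.coprod_self h₂ hm hn
  rw [hrank] at h
  exact (copiesCoprodFree H _ r hg).trans h

end EmbedsWithIndex

theorem embedsWithIndex_freeProdOfProducts {a b p q x y r : ℕ} (hx : x ≠ 0) (hy : y ≠ 0)
    (hax : a ∣ x) (hpx : p ∣ x) (hby : b ∣ y) (hqy : q ∣ y)
    (hr : r + x * y * (a * b + p * q) = (x * y) ^ 2) :
    EmbedsWithIndex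
      (CopiesCoprodFree (Fin (x * y * (a * b + p * q)))
        (FreeGroupOfRank (x + 1) × FreeGroupOfRank (y + 1)) (Fin (r + 1)))
      (FreeProdOfProducts (a + 1) (b + 1) (p + 1) (q + 1)) ((x * y) ^ 2) := by
  have free {z c k : ℕ} (hz : z ≠ 0) (hk : z = c * k) :
      EmbedsWithIndex (FreeGroupOfRank (z + 1)) (FreeGroupOfRank (c + 1)) k := by
    rw [hk, mul_comm] at hz ⊢
    exact .freeGroupOfRank c (left_ne_zero_of_mul hz)
  obtain ⟨i, hi⟩ := hax
  obtain ⟨j, hj⟩ := hpx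
  obtain ⟨k, hk⟩ := hby
  obtain ⟨l, hl⟩ := hqy
  have hm : x * y = a * b * (i * k) := by rw [hi, hk, mul_mul_mul_comm]
  have hn : x * y = p * q * (j * l) := by rw [hj, hl, mul_mul_mul_comm]
  have hm₀ : a * b * (i * k) ≠ 0 := hm ▸ mul_ne_zero hx hy
  have hn₀ : p * q * (j * l) ≠ 0 := hn ▸ mul_ne_zero hx hy
  have hg : a * b * (p * q) ≠ 0 :=
    mul_ne_zero (left_ne_zero_of_mul hm₀) (left_ne_zero_of_mul hn₀)
  have hcopies : x * y * (a * b + p * q) = a * b * (p * q) * (j * l + i * k) := by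
    rw [mul_add]; nth_rw 1 [hn]; rw [hm]; ring
  have hindex : (x * y) ^ 2 = a * b * (p * q) * (i * k * (j * l)) := by
    rw [sq]; nth_rw 1 [hm]; rw [hn]; ring
  rw [hcopies, hindex] at hr ⊢
  obtain ⟨r, rfl⟩ : a * b * (p * q) ∣ r :=
    (Nat.dvd_add_iff_left (dvd_mul_right _ _)).2 (hr ▸ dvd_mul_right _ _)
  refine .coprod_self_cover ((free hx hi).prod (free hy hk)) ((free hx hj).prod (free hy hl))
    (right_ne_zero_of_mul hm₀) (right_ne_zero_of_mul hn₀) hg ?_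
  exact Nat.eq_of_mul_eq_mul_left (Nat.pos_of_ne_zero hg) (by rw [mul_add, hr])

theorem abstractlyCommensurable_freeProdOfProducts_succ {a b p q c d s t : ℕ} (ha : a ≠ 0)
    (hb : b ≠ 0) (hp : p ≠ 0) (hq : q ≠ 0) (hc : c ≠ 0) (hd : d ≠ 0) (hs : s ≠ 0) (ht : t ≠ 0)
    (h : a * b + p * q = c * d + s * t) :
    AbstractlyCommensurable (FreeProdOfProducts (a + 1) (b + 1) (p + 1) (q + 1))
      (FreeProdOfProducts (c + 1) (d + 1) (s + 1) (t + 1)) := by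
  obtain ⟨x, hx⟩ : ∃ x, x = 2 * (a * p * (c * s)) := ⟨_, rfl⟩
  obtain ⟨y, hy⟩ : ∃ y, y = b * q * (d * t) := ⟨_, rfl⟩
  have hx₀ : x ≠ 0 := by rw [hx]; positivity
  have hy₀ : y ≠ 0 := by rw [hy]; positivity
  have hle : a * b + p * q ≤ x * y := by
    have hab : 1 ≤ a * b := Nat.one_le_iff_ne_zero.2 (mul_ne_zero ha hb)
    have hpq : 1 ≤ p * q := Nat.one_le_iff_ne_zero.2 (mul_ne_zero hp hq)
    calc a * b + p * q ≤ 2 * (a * b * (p * q)) := by nlinarith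
      _ ≤ 2 * (a * b * (p * q)) * (c * s * (d * t)) :=
        Nat.le_mul_of_pos_right _ (by positivity)
      _ = x * y := by rw [hx, hy]; ring
  obtain ⟨r, hr⟩ : ∃ r, r + x * y * (a * b + p * q) = (x * y) ^ 2 :=
    ⟨_, Nat.sub_add_cancel (by rw [sq]; exact Nat.mul_le_mul_left _ hle)⟩
  have h₁ := embedsWithIndex_freeProdOfProducts (a := a) (b := b) (p := p) (q := q) hx₀ hy₀
    ⟨2 * (p * (c * s)), by rw [hx]; ring⟩ ⟨2 * (a * (c * s)), by rw [hx]; ring⟩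
    ⟨q * (d * t), by rw [hy]; ring⟩ ⟨b * (d * t), by rw [hy]; ring⟩ hr
  have h₂ := embedsWithIndex_freeProdOfProducts (a := c) (b := d) (p := s) (q := t) hx₀ hy₀
    ⟨2 * (s * (a * p)), by rw [hx]; ring⟩ ⟨2 * (c * (a * p)), by rw [hx]; ring⟩
    ⟨t * (b * q), by rw [hy]; ring⟩ ⟨d * (b * q), by rw [hy]; ring⟩ (h ▸ hr)
  rw [← h] at h₂
  exact h₁.abstractlyCommensurable h₂ (by positivity) (by positivity)

theorem mainTheorem9 (a b p q c d s t : ℕ)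
    (ha : 2 ≤ a) (hb : 2 ≤ b) (hp : 2 ≤ p) (hq : 2 ≤ q)
    (hc : 2 ≤ c) (hd : 2 ≤ d) (hs : 2 ≤ s) (ht : 2 ≤ t)
    (h : ((a : ℤ) - 1) * ((b : ℤ) - 1) + ((p : ℤ) - 1) * ((q : ℤ) - 1)
      = ((c : ℤ) - 1) * ((d : ℤ) - 1) + ((s : ℤ) - 1) * ((t : ℤ) - 1)) :
    AbstractlyCommensurable (FreeProdOfProducts a b p q) (FreeProdOfProducts c d s t) := by
  obtain ⟨a, rfl⟩ := Nat.exists_eq_add_of_le' ha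
  obtain ⟨b, rfl⟩ := Nat.exists_eq_add_of_le' hb
  obtain ⟨p, rfl⟩ := Nat.exists_eq_add_of_le' hp
  obtain ⟨q, rfl⟩ := Nat.exists_eq_add_of_le' hq
  obtain ⟨c, rfl⟩ := Nat.exists_eq_add_of_le' hc
  obtain ⟨d, rfl⟩ := Nat.exists_eq_add_of_le' hd
  obtain ⟨s, rfl⟩ := Nat.exists_eq_add_of_le' hs
  obtain ⟨t, rfl⟩ := Nat.exists_eq_add_of_le' ht
  refine abstractlyCommensurable_freeProdOfProducts_succ a.succ_ne_zero b.succ_ne_zero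
    p.succ_ne_zero q.succ_ne_zero c.succ_ne_zero d.succ_ne_zero s.succ_ne_zero t.succ_ne_zero ?_
  zify
  push_cast at h
  linear_combination h
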